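/- Let $k$ be a field. For a finite simple graph $G$ with vertex set $V$, let $S = k[x_v : v\in V]$, let $I(G)\subseteq S$ be the ideal generated by the monomials $x_ux_v$ with $\{u,v\}$ an edge of $G$, let $k[G]=S/I(G)$ be the edge ring, and let $\mathrm{pd}(k[G])$ be its projective dimension as an $S$-module. Let $r\ge 1$ and let $K_{r,r}$ be the complete bipartite graph with both parts of size $r$. Then $I(K_{r,r})$ is the Stanley--Reisner ideal of the disjoint union of two $(r-1)$-simplices (so $k[K_{r,r}]$ is the Stanley--Reisner ring of this complex), $k[K_{r,r}]$ has a $2$-linear resolution, i.e. there is an exact complex of graded $S$-modules $$0\leftarrow k[K_{r,r}]\leftarrow S\leftarrow S[-2]^{b_1}\leftarrow S[-3]^{b_2}\leftarrow\cdots\leftarrow S[-p-1]^{b_p}\leftarrow 0,$$ and $$\mathrm{pd}(k[K_{r,r}]) = 2r-1,\qquad \mathrm{pd}(k[K_{r,r}])-\max\{\deg v : v\in K_{r,r}\} = r-1 .$$ Consequently, over every field $k$ and for every $N$ there is a finite graph $G$ such that $k[G]$ has a $2$-linear resolution and $\mathrm{pd}(k[G])-\max\{\deg v : v\in G\}\ge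 N$; that is, the gap in the conjecture that $\mathrm{pd}(k[G])$ equals the maximal degree of $G$ whenever $k[G]$ has a $2$-linear resolution can be arbitrarily large. -/

import Mathlib

universe u v

open MvPolynomial

/-- The edge ideal of a graph: generated by the monomials `x_i x_j`, `{i, j}` an edge. -/
noncomputable def edgeIdeal (k : Type u) [Field k] {V : Type v} (G : SimpleGraph V) :
    Ideal (MvPolynomial V k) :=
  Ideal.span {f | ∃ i j : V, G.Adj i j ∧ f = X i * X j}

/-- The edge ring of a graph: the polynomial ring modulo the edge ideal. -/
abbrev EdgeRing (k : Type u) [Field k] {V : Type v} (G : SimpleGraph V) : Type (max u v) :=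
  MvPolynomial V k ⧸ edgeIdeal k G

/-- The projective dimension of the edge ring as a module over the polynomial ring. -/
noncomputable def edgeRingProjDim (k : Type u) [Field k] {V : Type v} (G : SimpleGraph V) :
    WithBot ℕ∞ :=
  CategoryTheory.projectiveDimension
    (ModuleCat.of.{max u v} (MvPolynomial V k) (EdgeRing k G))

/-- The Stanley-Reisner ideal of a simplicial complex: generated by the squarefree monomials
whose support is not a face. (In Mathlib the empty face is left implicit, so only nonempty
sets of vertices are considered.) -/
noncomputable def stanleyReisnerIdeal (k : Type u) [Field k] {V : Type v} (D : AbstractSimplicialComplex V) :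
    Ideal (MvPolynomial V k) :=
  Ideal.span {f | ∃ s : Finset V, s.Nonempty ∧ s ∉ D.faces ∧ f = ∏ i ∈ s, X i}

/-- The full simplex on the vertex set `V`: every nonempty finite set of vertices is a face.
It has dimension `Fintype.card V - 1`. -/
abbrev fullSimplex (V : Type v) : AbstractSimplicialComplex V := ⊤

/-- The disjoint union of two simplicial complexes, on the disjoint union of the vertex sets. -/
def disjointUnionComplex {V W : Type v} [DecidableEq V] [DecidableEq W]
    (D : AbstractSimplicialComplex V) (E : AbstractSimplicialComplex W) :
    AbstractSimplicialComplex (V ⊕ W) where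
  toPreAbstractSimplicialComplex :=
    D.toPreAbstractSimplicialComplex.map Sum.inl ⊔ E.toPreAbstractSimplicialComplex.map Sum.inr
  singleton_mem x := by
    rcases x with x | x
    · exact Or.inl ⟨{x}, D.singleton_mem x, Finset.image_singleton _ _⟩
    · exact Or.inr ⟨{x}, E.singleton_mem x, Finset.image_singleton _ _⟩

/-- `S / I` has a `2`-linear resolution over the polynomial ring `S`: there is an exact complex
`0 ← S / I ← S ← S[-2]^{b₁} ← S[-3]^{b₂} ← ⋯ ← S[-p-1]^{b_p} ← 0` of graded free modules of
finite rank. Here `ι i` indexes a basis of the module `S[-i-2]^{b_{i+1}}`; the map to `S` is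
given by a row `q` of quadratic forms generating `I`, and the map from the module at `ι (i + 1)`
to that at `ι i` by a matrix `A i` of linear forms. -/
def HasTwoLinearResolution {k : Type u} [Field k] {V : Type v}
    (I : Ideal (MvPolynomial V k)) : Prop :=
  ∃ (ι : ℕ → Type) (_ : ∀ i, Fintype (ι i)) (q : ι 0 → MvPolynomial V k)
    (A : ∀ i, Matrix (ι i) (ι (i + 1)) (MvPolynomial V k)),
    (∃ p, ∀ i, p ≤ i → IsEmpty (ι i)) ∧
    (∀ j, (q j).IsHomogeneous 2) ∧
    (∀ i a b, (A i a b).IsHomogeneous 1) ∧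
    Ideal.span (Set.range q) = I ∧
    Function.Exact (A 0).mulVecLin (Fintype.linearCombination (MvPolynomial V k) q) ∧
    ∀ i, Function.Exact (A (i + 1)).mulVecLin (A i).mulVecLin

instance completeBipartiteGraphDecidableAdj (V W : Type v) :
    DecidableRel (completeBipartiteGraph V W).Adj :=
  fun a b => inferInstanceAs (Decidable (a.isLeft ∧ b.isRight ∨ a.isRight ∧ b.isLeft))

/-! Write `x_v`, `y_w` for the variables of the two sides.

Linearity comes from linear quotients. The generators `x_v y_w` are adjoined one at a time, row by
row; by `mul_mem_bipartiteIdeal_iff` the colon of the ideal built so far by the next generator is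
generated by variables. Such an ideal has a linear resolution of Koszul type
(`hasLinearResolution_span_X_image`), and `HasLinearResolution.sup_span_singleton` splices it in as
a mapping cone. The comparison map can be chosen with linear entries, so the cone is again linear.

The projective dimension comes from `I(K) = (x) ∩ (y)` and the exact sequence `0 → S/(x)∩(y) → S/(x)
× S/(y) → S/(x,y) → 0`. A quotient by `n` variables has projective dimension exactly `n`: at most
`n` by adjoining the variables as a regular sequence, at least `n` because `Ext^n` into `S/(all
variables)` is nonzero. The right-hand term therefore has projective dimension `2r`, the middle one
only `r`, and the left one `2r - 1`. Every vertex has degree `r`, which leaves the gap `r - 1`. -/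

/-- The ideal `I` has a linear resolution with generators in degree `d`. -/
def HasLinearResolution {k : Type u} [Field k] {V : Type v} (d : ℕ)
    (I : Ideal (MvPolynomial V k)) : Prop :=
  ∃ (ι : ℕ → Type) (_ : ∀ i, Fintype (ι i)) (q : ι 0 → MvPolynomial V k)
    (A : ∀ i, Matrix (ι i) (ι (i + 1)) (MvPolynomial V k)),
    (∃ p, ∀ i, p ≤ i → IsEmpty (ι i)) ∧
    (∀ j, (q j).IsHomogeneous d) ∧
    (∀ i a b, (A i a b).IsHomogeneous 1) ∧
    Ideal.span (Set.range q) = I ∧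
    Function.Exact (A 0).mulVecLin (Fintype.linearCombination (MvPolynomial V k) q) ∧
    ∀ i, Function.Exact (A (i + 1)).mulVecLin (A i).mulVecLin

theorem hasTwoLinearResolution_iff {k : Type u} [Field k] {V : Type v}
    {I : Ideal (MvPolynomial V k)} : HasTwoLinearResolution I ↔ HasLinearResolution 2 I :=
  Iff.rfl

/-! ### Homogeneous lifting and block matrices -/

section LinearResolution

variable {k : Type u} [Field k] {V : Type v}

theorem homogeneousComponent_mul_of_isHomogeneous {m : ℕ} {f : MvPolynomial V k}
    (hf : f.IsHomogeneous m) (g : MvPolynomial V k) (n : ℕ) :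
    homogeneousComponent (m + n) (f * g) = f * homogeneousComponent n g := by
  let := MvPolynomial.gradedAlgebra (σ := V) (R := k)
  have := DirectSum.coe_decompose_mul_add_of_left_mem (homogeneousSubmodule V k) (i := m) (j := n)
    (a := f) (b := g) hf
  rwa [← decomposition.decompose'_apply, ← decomposition.decompose'_apply g]

/-- Any solution may be replaced by its degree `e` component, because `A` shifts degrees by exactly
`d`. This is what keeps the entries of the comparison maps linear. -/
theorem exists_isHomogeneous_mulVec_eq {m n : Type*} [Fintype n] {d e : ℕ}
    {A : Matrix m n (MvPolynomial V k)} (hA : ∀ i j, (A i j).IsHomogeneous d)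
    {y : m → MvPolynomial V k} (hy : ∀ i, (y i).IsHomogeneous (d + e))
    (h : y ∈ LinearMap.range A.mulVecLin) :
    ∃ w : n → MvPolynomial V k, (∀ j, (w j).IsHomogeneous e) ∧ A.mulVec w = y := by
  obtain ⟨w, rfl⟩ := h
  refine ⟨fun j => homogeneousComponent e (w j),
    fun j => homogeneousComponent_isHomogeneous _ _, funext fun i => ?_⟩
  rw [← homogeneousComponent_eq_self (hy i)]
  simp only [Matrix.mulVec, dotProduct, Matrix.mulVecLin_apply, map_sum]
  exact Finset.sum_congr rfl fun j _ =>
    (homogeneousComponent_mul_of_isHomogeneous (hA i j) _ _).symm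

theorem exists_isHomogeneous_mul_eq {m n p : Type*} [Fintype n] [Fintype p] {d e : ℕ}
    {A : Matrix m n (MvPolynomial V k)} (hA : ∀ i j, (A i j).IsHomogeneous d)
    {Y : Matrix m p (MvPolynomial V k)} (hY : ∀ i j, (Y i j).IsHomogeneous (d + e))
    (h : ∀ w, Y.mulVec w ∈ LinearMap.range A.mulVecLin) :
    ∃ W : Matrix n p (MvPolynomial V k), (∀ i j, (W i j).IsHomogeneous e) ∧ A * W = Y := by
  classical
  choose w hw hw' using fun j : p => exists_isHomogeneous_mulVec_eq hA (y := fun i => Y i j)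
    (fun i => hY i j) (by convert h (Pi.single j 1); simp [Matrix.col])
  refine ⟨Matrix.of fun i j => w j i, fun i j => hw j i, ?_⟩
  exact Matrix.ext fun i j => congrFun (hw' j) i

theorem isHomogeneous_matrix_mul {m n p : Type*} [Fintype n] {d e : ℕ}
    {A : Matrix m n (MvPolynomial V k)} (hA : ∀ i j, (A i j).IsHomogeneous d)
    {B : Matrix n p (MvPolynomial V k)} (hB : ∀ i j, (B i j).IsHomogeneous e) (i : m) (j : p) :
    ((A * B) i j).IsHomogeneous (d + e) :=
  IsHomogeneous.sum _ _ _ fun x _ => (hA i x).mul (hB x j)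

theorem mul_eq_zero_of_exact_mulVecLin {R : Type*} [CommRing R] {l m n : Type*}
    [Fintype m] [Fintype n] {A : Matrix m n R} {B : Matrix l m R}
    (h : Function.Exact A.mulVecLin B.mulVecLin) : B * A = 0 := by
  classical
  refine Matrix.toLin'.injective ?_
  rw [Matrix.toLin'_apply', Matrix.mulVecLin_mul, h.linearMap_comp_eq_zero, map_zero]

/-- Splicing of block triangular matrices: exactness of a mapping cone. -/
theorem exact_mulVecLin_fromBlocks {R : Type*} [CommRing R] {m₀ m₁ m₂ n₀ n₁ n₂ : Type*}
    [Fintype m₁] [Fintype m₂] [Fintype n₁] [Fintype n₂]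
    {A₁ : Matrix m₀ m₁ R} {A₂ : Matrix m₁ m₂ R} {B₁ : Matrix n₀ n₁ R} {B₂ : Matrix n₁ n₂ R}
    {C₁ : Matrix m₀ n₁ R} {C₂ : Matrix m₁ n₂ R} (hA : Function.Exact A₂.mulVecLin A₁.mulVecLin)
    (hB : B₁ * B₂ = 0) (hC : A₁ * C₂ = - (C₁ * B₂))
    (h : ∀ w, B₁.mulVec w = 0 → C₁.mulVec w ∈ LinearMap.range A₁.mulVecLin →
      w ∈ LinearMap.range B₂.mulVecLin) :
    Function.Exact (Matrix.fromBlocks A₂ C₂ 0 B₂).mulVecLin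
      (Matrix.fromBlocks A₁ C₁ 0 B₁).mulVecLin := by
  have hA' : A₁ * A₂ = 0 := mul_eq_zero_of_exact_mulVecLin hA
  intro x
  simp only [Matrix.mulVecLin_apply]
  constructor
  · intro hx
    rw [Matrix.fromBlocks_mulVec] at hx
    have h1 : A₁.mulVec (x ∘ Sum.inl) + C₁.mulVec (x ∘ Sum.inr) = 0 :=
      funext fun i => congrFun hx (Sum.inl i)
    have h2 : B₁.mulVec (x ∘ Sum.inr) = 0 := by
      simpa using (funext fun i => congrFun hx (Sum.inr i) :
        Matrix.mulVec 0 (x ∘ Sum.inl) + B₁.mulVec (x ∘ Sum.inr) = 0)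
    -- First lift the lower component; the upper one, corrected by `C₂ w`, is then a cycle for `A₁`.
    obtain ⟨w, hw⟩ := h _ h2 ⟨-(x ∘ Sum.inl), by
      rw [Matrix.mulVecLin_apply, Matrix.mulVec_neg]; exact neg_eq_of_add_eq_zero_right h1⟩
    rw [Matrix.mulVecLin_apply] at hw
    obtain ⟨z, hz⟩ := (hA (x ∘ Sum.inl - C₂.mulVec w)).1 (by
      rw [Matrix.mulVecLin_apply, Matrix.mulVec_sub, Matrix.mulVec_mulVec, hC, Matrix.neg_mulVec,
        ← Matrix.mulVec_mulVec, hw, sub_neg_eq_add, h1])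
    rw [Matrix.mulVecLin_apply] at hz
    refine ⟨Sum.elim z w, ?_⟩
    rw [Matrix.mulVecLin_apply, Matrix.fromBlocks_mulVec]
    ext (i | i)
    · simp [hz]
    · simp [hw]
  · rintro ⟨y, rfl⟩
    rw [Matrix.mulVecLin_apply, Matrix.mulVec_mulVec, Matrix.fromBlocks_multiply]
    simp [hA', hB, hC, Matrix.fromBlocks_zero]

end LinearResolution

section Augmentation

/-- The index types `κ`, shifted by one and preceded by a one-point type. -/
def augmentedIndex (κ : ℕ → Type) : ℕ → Type
  | 0 => Unit
  | i + 1 => κ i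

instance augmentedIndexFintype (κ : ℕ → Type) [∀ i, Fintype (κ i)] :
    ∀ i, Fintype (augmentedIndex κ i)
  | 0 => inferInstanceAs (Fintype Unit)
  | i + 1 => inferInstanceAs (Fintype (κ i))

/-- The matrices `B`, shifted by one and preceded by the row `q`. -/
def augmentedMatrix {R : Type*} {κ : ℕ → Type} (q : κ 0 → R)
    (B : ∀ i, Matrix (κ i) (κ (i + 1)) R) :
    ∀ i, Matrix (augmentedIndex κ i) (augmentedIndex κ (i + 1)) R
  | 0 => Matrix.replicateRow Unit q
  | i + 1 => B i

end Augmentation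

/-! ### Mapping cones of linear resolutions -/

section LinearResolution

variable {k : Type u} [Field k] {V : Type v}

theorem replicateRow_mulVec {R : Type*} [CommRing R] {κ : Type*} [Fintype κ] (q : κ → R) (w : κ → R)
    (x : Unit) : Matrix.mulVec (Matrix.replicateRow Unit q) w x = Fintype.linearCombination R q w := by
  simp [Matrix.mulVec, dotProduct, Matrix.replicateRow_apply, Fintype.linearCombination_apply, mul_comm]

theorem replicateRow_mulVec_eq_zero_iff {R : Type*} [CommRing R] {κ : Type*} [Fintype κ] (q : κ → R)
    (w : κ → R) : Matrix.mulVec (Matrix.replicateRow Unit q) w = 0 ↔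
      Fintype.linearCombination R q w = 0 := by
  rw [funext_iff]
  simp [replicateRow_mulVec]

theorem mem_range_replicateRow {R : Type*} [CommRing R] {κ : Type*} [Fintype κ] (q : κ → R)
    (y : Unit → R) : y ∈ LinearMap.range (Matrix.replicateRow Unit q).mulVecLin ↔
      y () ∈ Ideal.span (Set.range q) := by
  rw [Ideal.span, ← Fintype.range_linearCombination R q]
  constructor
  · rintro ⟨w, rfl⟩
    exact ⟨w, (replicateRow_mulVec q w ()).symm⟩
  · rintro ⟨w, hw⟩
    exact ⟨w, funext fun _ => (replicateRow_mulVec q w ()).trans hw⟩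

theorem exact_replicateRow_iff {R : Type*} [CommRing R] {κ M : Type*} [Fintype κ]
    (q : κ → R) (g : M → κ → R) :
    Function.Exact g (Matrix.replicateRow Unit q).mulVecLin ↔
      Function.Exact g (Fintype.linearCombination R q) :=
  forall_congr' fun w => by rw [Matrix.mulVecLin_apply, replicateRow_mulVec_eq_zero_iff]

theorem exists_seq_of_step {α : ℕ → Type*} {P : ∀ i, α i → Prop}
    {r : ∀ i, α i → α (i + 1) → Prop} {a₀ : α 0} (h₀ : P 0 a₀)
    (h : ∀ i a, P i a → ∃ b, P (i + 1) b ∧ r i a b) :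
    ∃ s : ∀ i, α i, s 0 = a₀ ∧ (∀ i, P i (s i)) ∧ ∀ i, r i (s i) (s (i + 1)) := by
  choose g hg hr using h
  let s : ∀ i, {a : α i // P i a} := fun i =>
    Nat.rec ⟨a₀, h₀⟩ (fun i a => ⟨g i a.1 a.2, hg i a.1 a.2⟩) i
  exact ⟨fun i => (s i).1, rfl, fun i => (s i).2, fun i => hr i _ _⟩

/-- Linear resolutions of `I` and of `J = (I : f)` combine to one of `I + (f)`. -/
theorem HasLinearResolution.sup_span_singleton {d : ℕ} {I J : Ideal (MvPolynomial V k)}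
    {f : MvPolynomial V k} (hI : HasLinearResolution d I) (hf : f.IsHomogeneous d)
    (hJ : HasLinearResolution 1 J) (hIJ : ∀ g, g ∈ J ↔ f * g ∈ I) :
    HasLinearResolution d (I ⊔ Ideal.span {f}) := by
  obtain ⟨ι, _, q, A, ⟨p, hp⟩, hq, hA, rfl, hex₀, hex⟩ := hI
  obtain ⟨κ, _, l, B, ⟨p', hp'⟩, hl, hB, rfl, hey₀, hey⟩ := hJ
  rw [← exact_replicateRow_iff] at hex₀ hey₀
  -- The `C i` lift multiplication by `-f` from the resolution of `J` to that of `I`, with a sign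
  -- change at each step. Since `f * l j` lies in `I` and has degree `d + 1`, the start `C₀` can be
  -- taken linear.
  obtain ⟨C₀, hC₀, hQC⟩ : ∃ C : Matrix (ι 0) (κ 0) (MvPolynomial V k),
      (∀ i j, (C i j).IsHomogeneous 1) ∧ Matrix.replicateRow Unit q * C =
        -(f • Matrix.replicateRow Unit l) := by
    refine exists_isHomogeneous_mul_eq (d := d)
      (A := Matrix.replicateRow Unit q) (Y := -(f • Matrix.replicateRow Unit l)) (fun _ j => hq j)
      (fun _ j => (hf.mul (hl j)).neg) fun w => ?_
    rw [mem_range_replicateRow, Matrix.neg_mulVec, Matrix.smul_mulVec]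
    refine neg_mem ((hIJ _).1 ?_)
    exact (mem_range_replicateRow l _).1 ⟨w, rfl⟩
  obtain ⟨C, hC0, hC, hAC⟩ := exists_seq_of_step
    (α := fun i => Matrix (ι i) (κ i) (MvPolynomial V k))
    (P := fun i C => (∀ a b, (C a b).IsHomogeneous 1) ∧
      ∀ w, (C * B i).mulVec w ∈ LinearMap.range (A i).mulVecLin)
    (r := fun i C C' => A i * C' = -(C * B i))
    ⟨hC₀, fun w => (hex₀ _).1 (by
      rw [Matrix.mulVecLin_apply, Matrix.mulVec_mulVec, ← Matrix.mul_assoc, hQC, Matrix.neg_mul, Matrix.smul_mul,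
        mul_eq_zero_of_exact_mulVecLin hey₀]
      simp)⟩
    (fun i C ⟨hC, hw⟩ => by
      obtain ⟨C', hC', h⟩ := exists_isHomogeneous_mul_eq (e := 1) (hA i) (Y := -(C * B i))
        (fun a b => (isHomogeneous_matrix_mul hC (hB i) a b).neg)
        (fun w => by rw [Matrix.neg_mulVec]; exact neg_mem (hw w))
      refine ⟨C', ⟨hC', fun w => (hex i _).1 ?_⟩, h⟩
      rw [Matrix.mulVecLin_apply, Matrix.mulVec_mulVec, ← Matrix.mul_assoc, h, Matrix.neg_mul, Matrix.mul_assoc,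
        mul_eq_zero_of_exact_mulVecLin (hey i)]
      simp)
  -- The shift makes the row `l` a linear map onto the one basis element for the new generator `f`;
  -- it also accounts for the `+ 1` in the length bound.
  let B' := augmentedMatrix l B
  refine ⟨fun i => ι i ⊕ augmentedIndex κ i, inferInstance, Sum.elim q fun _ => f,
    fun i => Matrix.fromBlocks (A i) (C i) 0 (B' i), ⟨p + p' + 1, ?_⟩, ?_, ?_, ?_, ?_, ?_⟩
  · rintro (_ | i) hi
    · omega
    · exact isEmpty_sum.2 ⟨hp _ (by omega), hp' i (by omega)⟩
  · rintro (j | j)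
    exacts [hq j, hf]
  · rintro i (a | a) (b | b)
    · exact hA i a b
    · exact (hC i).1 a b
    · exact isHomogeneous_zero _ _ _
    · cases i
      exacts [hl b, hB _ a b]
  · rw [Set.Sum.elim_range, Ideal.span_union]
    congr 2
    exact Set.range_const (ι := Unit)
  -- With an empty lower block the row of generators is block triangular too, so the cone lemma
  -- covers this end. Its range hypothesis becomes `f * w () ∈ I`, that is, `w () ∈ J`.
  · have key : Function.Exact
        (Matrix.fromBlocks (A 0) (C 0) 0 (Matrix.replicateRow Unit l)).mulVecLin
        (Matrix.fromBlocks (Matrix.replicateRow Unit q) (Matrix.of fun _ _ : Unit => f) 0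
          (0 : Matrix Empty Unit (MvPolynomial V k))).mulVecLin := by
      refine exact_mulVecLin_fromBlocks hex₀ (Subsingleton.elim _ _) ?_ fun w _ hw => ?_
      · rw [hC0, hQC]
        congr 1
        ext1 i j
        simp [Matrix.mul_apply]
      · rw [mem_range_replicateRow] at hw ⊢
        rw [hIJ]
        simpa [Matrix.mulVec, dotProduct] using hw
    have key' : Function.Exact
        (Matrix.fromBlocks (A 0) (C 0) 0 (Matrix.replicateRow Unit l)).mulVecLin
        (Fintype.linearCombination (MvPolynomial V k) (Sum.elim q fun _ : Unit => f)) := by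
      refine fun x => Iff.trans ?_ (key x)
      rw [Matrix.mulVecLin_apply, Matrix.fromBlocks_mulVec, funext_iff]
      simp [Fintype.linearCombination_apply, Matrix.mulVec, dotProduct, mul_comm]
    exact key'
  · rintro i
    refine exact_mulVecLin_fromBlocks (hex i) ?_ (hAC i) fun w hw _ => ?_
    · cases i
      exacts [mul_eq_zero_of_exact_mulVecLin hey₀, mul_eq_zero_of_exact_mulVecLin (hey _)]
    · cases i
      exacts [(hey₀ w).1 hw, (hey _ w).1 hw]

theorem hasLinearResolution_bot (d : ℕ) :
    HasLinearResolution d (⊥ : Ideal (MvPolynomial V k)) := by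
  refine ⟨fun _ => Empty, fun _ => inferInstance, Empty.elim, fun _ => 0,
    ⟨0, fun _ _ => inferInstance⟩, fun j => j.elim, fun _ a => a.elim, ?_, ?_, ?_⟩
  · simp
  · exact fun x => ⟨fun _ => ⟨0, Subsingleton.elim _ _⟩, fun _ => by simp [Subsingleton.elim x 0]⟩
  · exact fun _ x => ⟨fun _ => ⟨0, Subsingleton.elim _ _⟩, fun _ => Subsingleton.elim _ _⟩

end LinearResolution

/-! ### Colon ideals and decompositions of monomial ideals -/

section MonomialIdeals

variable {k : Type u} [Field k] {V W : Type v}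

/-- Membership depends only on the exponents of the variables in `s`, and multiplying by `X v`
leaves these unchanged. -/
theorem X_mul_mem_span_X_image {s : Set V} {v : V} (hv : v ∉ s) {g : MvPolynomial V k} :
    X v * g ∈ Ideal.span (X '' s) ↔ g ∈ Ideal.span (X '' s : Set (MvPolynomial V k)) := by
  classical
  rw [mem_ideal_span_X_image, mem_ideal_span_X_image, support_X_mul]
  simp only [Finset.mem_map, addLeftEmbedding_apply, forall_exists_index, and_imp,
    forall_apply_eq_imp_iff₂]
  refine forall₂_congr fun m _ => exists_congr fun i => and_congr_right fun hi => ?_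
  have : v ≠ i := fun h => hv (h ▸ hi)
  simp [Finsupp.single_eq_of_ne' this]

theorem hasLinearResolution_span_X_image (s : Finset V) :
    HasLinearResolution 1 (Ideal.span (X '' (s : Set V)) : Ideal (MvPolynomial V k)) := by
  classical
  induction s using Finset.induction_on with
  | empty => simpa using hasLinearResolution_bot 1
  | insert v s hv ih =>
    rw [Finset.coe_insert, Set.image_insert_eq, Ideal.span_insert, sup_comm]
    -- The new variable is a nonzerodivisor modulo the old ideal, so the colon is that ideal itself
    -- and its resolution is spliced with itself, as in the Koszul complex.
    exact ih.sup_span_singleton (isHomogeneous_X k v) ih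
      fun g => (X_mul_mem_span_X_image (by simpa using hv)).symm

/-- The ideal generated by the monomials `x_v y_w` with `(v, w) ∈ T`. -/
noncomputable def bipartiteIdeal (k : Type u) [Field k] (T : Set (V × W)) :
    Ideal (MvPolynomial (V ⊕ W) k) :=
  Ideal.span ((fun p : V × W => X (Sum.inl p.1) * X (Sum.inr p.2)) '' T)

theorem mem_bipartiteIdeal_iff {T : Set (V × W)} {g : MvPolynomial (V ⊕ W) k} :
    g ∈ bipartiteIdeal k T ↔
      ∀ m ∈ g.support, ∃ v w, (v, w) ∈ T ∧ m (Sum.inl v) ≠ 0 ∧ m (Sum.inr w) ≠ 0 := by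
  have h : (fun p : V × W => (X (Sum.inl p.1) * X (Sum.inr p.2) : MvPolynomial (V ⊕ W) k)) '' T =
      (fun s => monomial s 1) ''
        ((fun p : V × W => Finsupp.single (Sum.inl p.1) 1 + Finsupp.single (Sum.inr p.2) 1) '' T) := by
    rw [Set.image_image]
    exact Set.image_congr fun p _ => by rw [X, X, monomial_mul, one_mul]
  rw [bipartiteIdeal, h, mem_ideal_span_monomial_image]
  refine forall₂_congr fun m _ => ?_
  constructor
  · rintro ⟨_, ⟨⟨v, w⟩, hT, rfl⟩, hle⟩
    refine ⟨v, w, hT, ?_, ?_⟩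
    · have := hle (Sum.inl v); simp at this; omega
    · have := hle (Sum.inr w); simp at this; omega
  · rintro ⟨v, w, hT, hv, hw⟩
    refine ⟨_, ⟨⟨v, w⟩, hT, rfl⟩, ?_⟩
    classical
    rintro (a | a)
    · by_cases h : v = a
      · subst h; simp; omega
      · simp [h]
    · by_cases h : w = a
      · subst h; simp; omega
      · simp [h]

theorem bipartiteIdeal_insert (T : Set (V × W)) (v : V) (w : W) :
    bipartiteIdeal k (insert (v, w) T) =
      bipartiteIdeal k T ⊔ Ideal.span {X (Sum.inl v) * X (Sum.inr w)} := by
  rw [bipartiteIdeal, Set.image_insert_eq, Ideal.span_insert, sup_comm, bipartiteIdeal]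

/-- The colon ideal of the ideal of the first `A` rows and of part `B` of row `v` by the next
generator is generated by variables. -/
theorem mul_mem_bipartiteIdeal_iff {A : Set V} {B : Set W} {v : V} {w : W} (hv : v ∉ A)
    (hw : w ∉ B) {g : MvPolynomial (V ⊕ W) k} :
    X (Sum.inl v) * X (Sum.inr w) * g ∈ bipartiteIdeal k (A ×ˢ Set.univ ∪ {v} ×ˢ B) ↔
      g ∈ Ideal.span (X '' (Sum.inl '' A ∪ Sum.inr '' B)) := by
  classical
  rw [mem_ideal_span_X_image, mem_bipartiteIdeal_iff, mul_assoc, support_X_mul, support_X_mul]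
  simp only [Finset.mem_map, addLeftEmbedding_apply, forall_exists_index, and_imp,
    forall_apply_eq_imp_iff₂]
  refine forall₂_congr fun m _ => ?_
  constructor
  · rintro ⟨a, b, (⟨ha, -⟩ | ⟨rfl, hb⟩), h1, h2⟩
    · refine ⟨_, Or.inl ⟨a, ha, rfl⟩, ?_⟩
      have : v ≠ a := fun h => hv (h ▸ ha)
      simpa [Finsupp.single_apply, this] using h1
    · refine ⟨_, Or.inr ⟨b, hb, rfl⟩, ?_⟩
      have : w ≠ b := fun h => hw (h ▸ hb)
      simpa [Finsupp.single_apply, this] using h2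
  · rintro ⟨_, (⟨a, ha, rfl⟩ | ⟨b, hb, rfl⟩), h⟩
    · exact ⟨a, w, Or.inl ⟨ha, trivial⟩, by simp [h], by simp⟩
    · exact ⟨v, b, Or.inr ⟨rfl, hb⟩, by simp, by simp [h]⟩

theorem hasLinearResolution_bipartiteIdeal_prod [Fintype W] (A : Finset V) :
    HasLinearResolution 2 (bipartiteIdeal k ((A : Set V) ×ˢ (Set.univ : Set W))) := by
  classical
  induction A using Finset.induction_on with
  | empty => simpa [bipartiteIdeal] using hasLinearResolution_bot 2
  | insert v A hv ih =>
    -- Inner induction along row `v`: `B` holds the columns already adjoined.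
    suffices h : ∀ B : Finset W, HasLinearResolution 2
        (bipartiteIdeal k ((A : Set V) ×ˢ (Set.univ : Set W) ∪ {v} ×ˢ (B : Set W))) by
      convert h Finset.univ using 2
      rw [Finset.coe_univ, ← Set.union_prod, Finset.coe_insert, Set.union_singleton]
    intro B
    induction B using Finset.induction_on with
    | empty => simpa using ih
    | insert w B hw ihB =>
      rw [Finset.coe_insert, Set.singleton_prod, Set.image_insert_eq, Set.union_insert,
        bipartiteIdeal_insert, ← Set.singleton_prod]
      refine ihB.sup_span_singleton (isHomogeneous_X k _ |>.mul (isHomogeneous_X k _))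
        (hasLinearResolution_span_X_image (A.disjSum B)) fun g => ?_
      rw [mul_mem_bipartiteIdeal_iff (by simpa using hv) (by simpa using hw)]
      congr! 3
      ext (x | x) <;> simp

theorem edgeIdeal_completeBipartiteGraph :
    edgeIdeal k (completeBipartiteGraph V W) = bipartiteIdeal k Set.univ := by
  rw [edgeIdeal, bipartiteIdeal]
  congr 1
  ext f
  constructor
  · rintro ⟨i | i, j | j, h, rfl⟩
    · simp at h
    · exact ⟨(i, j), trivial, rfl⟩
    · exact ⟨(j, i), trivial, mul_comm _ _⟩
    · simp at h
  · rintro ⟨⟨i, j⟩, -, rfl⟩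
    exact ⟨Sum.inl i, Sum.inr j, by simp, rfl⟩

/-- A monomial is divisible by some `x_v y_w` exactly when it involves a variable from each side. -/
theorem bipartiteIdeal_univ_eq_inf :
    bipartiteIdeal k (Set.univ : Set (V × W)) =
      Ideal.span (X '' Set.range Sum.inl) ⊓ Ideal.span (X '' Set.range Sum.inr) := by
  ext g
  rw [Ideal.mem_inf, mem_ideal_span_X_image, mem_ideal_span_X_image, mem_bipartiteIdeal_iff]
  constructor
  · intro h
    constructor
    · intro m hm
      obtain ⟨v, w, -, hv, hw⟩ := h m hm
      exact ⟨_, ⟨v, rfl⟩, hv⟩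
    · intro m hm
      obtain ⟨v, w, -, hv, hw⟩ := h m hm
      exact ⟨_, ⟨w, rfl⟩, hw⟩
  · rintro ⟨h1, h2⟩ m hm
    obtain ⟨_, ⟨v, rfl⟩, hv⟩ := h1 m hm
    obtain ⟨_, ⟨w, rfl⟩, hw⟩ := h2 m hm
    exact ⟨v, w, trivial, hv, hw⟩

theorem hasTwoLinearResolution_completeBipartiteGraph [Fintype V] [Fintype W] :
    HasTwoLinearResolution (edgeIdeal k (completeBipartiteGraph V W)) := by
  rw [edgeIdeal_completeBipartiteGraph, hasTwoLinearResolution_iff]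
  simpa using hasLinearResolution_bipartiteIdeal_prod (k := k) (W := W) (Finset.univ : Finset V)

theorem edgeIdeal_completeBipartiteGraph_eq_stanleyReisnerIdeal [DecidableEq V] [DecidableEq W] :
    edgeIdeal k (completeBipartiteGraph V W) =
      stanleyReisnerIdeal k (disjointUnionComplex (fullSimplex V) (fullSimplex W)) := by
  rw [edgeIdeal_completeBipartiteGraph]
  apply le_antisymm
  · rw [bipartiteIdeal, Ideal.span_le]
    rintro _ ⟨⟨v, w⟩, -, rfl⟩
    refine Ideal.subset_span ⟨{Sum.inl v, Sum.inr w}, by simp, ?_, by simp⟩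
    rintro (⟨s, -, h⟩ | ⟨s, -, h⟩)
    · have : Sum.inr w ∈ s.image Sum.inl := by
        rw [show s.image Sum.inl = _ from h]; simp
      simp at this
    · have : Sum.inl v ∈ s.image Sum.inr := by
        rw [show s.image Sum.inr = _ from h]; simp
      simp at this
  · rw [stanleyReisnerIdeal, Ideal.span_le]
    rintro _ ⟨s, hs, hface, rfl⟩
    -- A nonempty set lying on one side is a face, so a nonface meets both sides and its monomial is
    -- a multiple of some `x_v y_w`.
    obtain ⟨v, hv⟩ : ∃ v, Sum.inl v ∈ s := by
      by_contra! h
      refine hface (Or.inr ⟨s.toRight, ?_, ?_⟩)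
      · obtain ⟨x | x, hx⟩ := hs
        exacts [absurd hx (h x), ⟨x, by simpa using hx⟩]
      · ext (x | x) <;> simp [h]
    obtain ⟨w, hw⟩ : ∃ w, Sum.inr w ∈ s := by
      by_contra! h
      refine hface (Or.inl ⟨s.toLeft, ?_, ?_⟩)
      · obtain ⟨x | x, hx⟩ := hs
        exacts [⟨x, by simpa using hx⟩, absurd hx (h x)]
      · ext (x | x) <;> simp [h]
    refine Ideal.mem_of_dvd _ ?_ (Ideal.subset_span ⟨(v, w), trivial, rfl⟩)
    dsimp only
    rw [← Finset.prod_pair (f := fun i => (X i : MvPolynomial (V ⊕ W) k))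
      (Sum.inl_ne_inr : (Sum.inl v : V ⊕ W) ≠ Sum.inr w)]
    exact Finset.prod_dvd_prod_of_subset _ _ _ (by simp [Finset.insert_subset_iff, hv, hw])

end MonomialIdeals

/-! ### Vertex degrees -/

theorem degree_completeBipartiteGraph {V W : Type v} [Fintype V] [Fintype W] (x : V ⊕ W) :
    (completeBipartiteGraph V W).degree x =
      Sum.elim (fun _ => Fintype.card W) (fun _ => Fintype.card V) x := by
  classical
  rw [← SimpleGraph.card_neighborFinset_eq_degree]
  rcases x with x | x
  · have : (completeBipartiteGraph V W).neighborFinset (Sum.inl x) =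
        Finset.univ.map Function.Embedding.inr := by
      ext (y | y) <;> simp
    rw [this]; simp
  · have : (completeBipartiteGraph V W).neighborFinset (Sum.inr x) =
        Finset.univ.map Function.Embedding.inl := by
      ext (y | y) <;> simp
    rw [this]; simp

theorem maxDegree_completeBipartiteGraph_fin {r : ℕ} (hr : 1 ≤ r) :
    (completeBipartiteGraph (Fin r) (Fin r)).maxDegree = r := by
  have h (x : Fin r ⊕ Fin r) : (completeBipartiteGraph (Fin r) (Fin r)).degree x = r := by
    rw [degree_completeBipartiteGraph]
    rcases x with x | x <;> simp
  refine le_antisymm (SimpleGraph.maxDegree_le_of_forall_degree_le _ _ fun x => (h x).le) ?_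
  exact (h (Sum.inl ⟨0, hr⟩)).ge.trans (SimpleGraph.degree_le_maxDegree _ _)

/-! ### Projective dimension and short exact sequences of quotients -/

section ProjectiveDimension

open CategoryTheory Abelian

variable {R : Type u} [CommRing R]

/-- The complex `R / I → R / I → R / (I + (x))`, the first map being multiplication by `x`. -/
noncomputable abbrev quotientMulShortComplex (I : Ideal R) (x : R) :
    ShortComplex (ModuleCat.{u} R) :=
  ModuleCat.shortComplexOfCompEqZero (M := R ⧸ I) (N := R ⧸ I)
    (L := R ⧸ (I ⊔ Ideal.span {x})) (x • LinearMap.id)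
    (Submodule.factor (le_sup_left : I ≤ I ⊔ Ideal.span {x})) (by
      ext
      refine (Submodule.Quotient.mk_eq_zero _ (x := x • (1 : R))).2 (Ideal.mem_sup_right ?_)
      simp)

theorem quotientMulShortComplex_shortExact {I : Ideal R} {x : R}
    (h : ∀ a, x * a ∈ I → a ∈ I) : (quotientMulShortComplex I x).ShortExact := by
  apply ModuleCat.shortComplex_shortExact
  · intro a
    obtain ⟨a, rfl⟩ := Submodule.Quotient.mk_surjective _ a
    refine (Submodule.Quotient.mk_eq_zero _).trans ?_
    constructor
    · intro ha
      obtain ⟨i, hi, y, hy, rfl⟩ := Submodule.mem_sup.1 ha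
      obtain ⟨z, rfl⟩ := Ideal.mem_span_singleton.1 hy
      refine ⟨Submodule.Quotient.mk z, (Submodule.Quotient.eq _).2 ?_⟩
      simpa using hi
    · rintro ⟨b, hb⟩
      obtain ⟨b, rfl⟩ := Submodule.Quotient.mk_surjective _ b
      have hb : x * b - a ∈ I := (Submodule.Quotient.eq _).1 hb
      have := (I ⊔ Ideal.span {x}).sub_mem (Ideal.mem_sup_right
        (Ideal.mul_mem_right b _ (Ideal.mem_span_singleton_self x))) (Ideal.mem_sup_left hb)
      simpa using this
  · refine (injective_iff_map_eq_zero' (x • LinearMap.id : R ⧸ I →ₗ[R] R ⧸ I)).2 fun a => ?_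
    obtain ⟨a, rfl⟩ := Submodule.Quotient.mk_surjective _ a
    refine (Submodule.Quotient.mk_eq_zero I (x := x • a)).trans ?_
    rw [Submodule.Quotient.mk_eq_zero]
    exact ⟨h a, fun ha => I.mul_mem_left x ha⟩
  · exact Submodule.factor_surjective (le_sup_left : I ≤ I ⊔ Ideal.span {x})

/-- The complex `R / (I ∩ J) → R / I × R / J → R / (I + J)`. -/
noncomputable abbrev quotientInfShortComplex (I J : Ideal R) : ShortComplex (ModuleCat.{u} R) :=
  ModuleCat.shortComplexOfCompEqZero (M := R ⧸ (I ⊓ J)) (N := (R ⧸ I) × (R ⧸ J)) (L := R ⧸ (I ⊔ J))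
    (LinearMap.prod (Submodule.factor inf_le_left) (Submodule.factor inf_le_right))
    (LinearMap.coprod (Submodule.factor le_sup_left) (-Submodule.factor le_sup_right)) (by
      ext
      simp)

theorem quotientInfShortComplex_shortExact (I J : Ideal R) :
    (quotientInfShortComplex I J).ShortExact := by
  apply ModuleCat.shortComplex_shortExact
  · rintro ⟨a, b⟩
    obtain ⟨a, rfl⟩ := Submodule.Quotient.mk_surjective _ a
    obtain ⟨b, rfl⟩ := Submodule.Quotient.mk_surjective _ b
    constructor
    · intro h
      have h : Submodule.Quotient.mk a + -Submodule.Quotient.mk b = (0 : R ⧸ (I ⊔ J)) := h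
      rw [← sub_eq_add_neg, sub_eq_zero, Submodule.Quotient.eq] at h
      obtain ⟨i, hi, j, hj, hij⟩ := Submodule.mem_sup.1 h
      refine ⟨Submodule.Quotient.mk (a - i), Prod.ext ((Submodule.Quotient.eq _).2 ?_)
        ((Submodule.Quotient.eq _).2 ?_)⟩
      · simpa using hi
      · have : a - i - b = j := by linear_combination -hij
        exact this ▸ hj
    · rintro ⟨c, hc⟩
      obtain ⟨c, rfl⟩ := Submodule.Quotient.mk_surjective _ c
      have h1 : c - a ∈ I := (Submodule.Quotient.eq _).1 (congrArg Prod.fst hc)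
      have h2 : c - b ∈ J := (Submodule.Quotient.eq _).1 (congrArg Prod.snd hc)
      change Submodule.Quotient.mk a + -Submodule.Quotient.mk b = (0 : R ⧸ (I ⊔ J))
      rw [← sub_eq_add_neg, sub_eq_zero, Submodule.Quotient.eq]
      have := sub_mem (Ideal.mem_sup_right (S := I) h2) (Ideal.mem_sup_left (T := J) h1)
      simpa using this
  · refine (injective_iff_map_eq_zero (LinearMap.prod
      (Submodule.factor (inf_le_left : I ⊓ J ≤ I)) (Submodule.factor inf_le_right))).2 fun a => ?_
    obtain ⟨a, rfl⟩ := Submodule.Quotient.mk_surjective _ a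
    intro h
    exact (Submodule.Quotient.mk_eq_zero _).2
      ⟨(Submodule.Quotient.mk_eq_zero _).1 (congrArg Prod.fst h),
        (Submodule.Quotient.mk_eq_zero _).1 (congrArg Prod.snd h)⟩
  · intro a
    obtain ⟨a, rfl⟩ := Submodule.Quotient.mk_surjective _ a
    exact ⟨(Submodule.Quotient.mk a, 0), by simp⟩

/-- The kernel of the connecting map `Ext^n → Ext^(n+1)` is the image of multiplication by `x`,
which vanishes because `x` kills `L`. So the connecting map is injective. -/
theorem nontrivial_ext_quotient_sup_span_singleton {I : Ideal R} {x : R}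
    (h : ∀ a, x * a ∈ I → a ∈ I) {L : ModuleCat.{u} R} (hL : x • 𝟙 L = 0) {n : ℕ}
    (hn : Nontrivial (Ext (ModuleCat.of R (R ⧸ I)) L n)) :
    Nontrivial (Ext (ModuleCat.of R (R ⧸ (I ⊔ Ideal.span {x}))) L (n + 1)) := by
  have hS := quotientMulShortComplex_shortExact h
  obtain ⟨e, he⟩ := exists_ne (0 : Ext (ModuleCat.of R (R ⧸ I)) L n)
  refine nontrivial_of_ne (hS.extClass.comp e (add_comm 1 n)) 0 fun h0 => he ?_
  obtain ⟨e', rfl⟩ := Ext.contravariant_sequence_exact₁ hS _ e (add_comm 1 n) h0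
  have hf : (quotientMulShortComplex I x).f = x • 𝟙 (ModuleCat.of R (R ⧸ I)) := rfl
  rw [hf, Ext.mk₀_smul, Ext.smul_comp, Ext.mk₀_id_comp, Ext.smul_eq_comp_mk₀, hL, Ext.mk₀_zero,
    Ext.comp_zero]

theorem hasProjectiveDimensionLT_prod {M N : Type u} [AddCommGroup M] [Module R M]
    [AddCommGroup N] [Module R N] {n : ℕ} (hM : HasProjectiveDimensionLT (ModuleCat.of R M) n)
    (hN : HasProjectiveDimensionLT (ModuleCat.of R N) n) :
    HasProjectiveDimensionLT (ModuleCat.of R (M × N)) n :=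
  hasProjectiveDimensionLT_of_iso
    (ModuleCat.biprodIsoProd (ModuleCat.of R M) (ModuleCat.of R N)) n

/-- Dimension shifting: the middle term has projective dimension at most `n`, so the value `n + 1`
on the right must come from the left term. -/
theorem projectiveDimension_quotient_inf_eq {I J : Ideal R} {n : ℕ}
    (hI : HasProjectiveDimensionLT (ModuleCat.of R (R ⧸ I)) (n + 1))
    (hJ : HasProjectiveDimensionLT (ModuleCat.of R (R ⧸ J)) (n + 1))
    (hIJ : projectiveDimension (ModuleCat.of R (R ⧸ (I ⊔ J))) = (n + 1 : ℕ)) :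
    projectiveDimension (ModuleCat.of R (R ⧸ (I ⊓ J))) = n := by
  have hS := quotientInfShortComplex_shortExact I J
  have hmid : HasProjectiveDimensionLT (quotientInfShortComplex I J).X₂ (n + 1) :=
    hasProjectiveDimensionLT_prod hI hJ
  apply le_antisymm
  · rw [projectiveDimension_le_iff]
    exact hS.hasProjectiveDimensionLT_X₁ _ hmid ((projectiveDimension_le_iff _ _).1 hIJ.le)
  · rw [projectiveDimension_ge_iff]
    exact fun h => (projectiveDimension_ge_iff _ _).1 hIJ.ge
      (hS.hasProjectiveDimensionLT_X₃ n h hmid)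

end ProjectiveDimension

/-! ### Quotients by variables and the edge ring -/

section EdgeRing

open CategoryTheory Abelian

variable {k : Type u} [Field k] {V W : Type v}

theorem hasProjectiveDimensionLT_quotient_span_X_image (s : Finset V) :
    HasProjectiveDimensionLT (ModuleCat.of (MvPolynomial V k)
      (MvPolynomial V k ⧸ Ideal.span (X '' (s : Set V) : Set (MvPolynomial V k)))) (s.card + 1) := by
  classical
  induction s using Finset.induction_on with
  | empty =>
    have : Projective (ModuleCat.of (MvPolynomial V k) (MvPolynomial V k ⧸
        Ideal.span (X '' ((∅ : Finset V) : Set V) : Set (MvPolynomial V k)))) := by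
      rw [← IsProjective.iff_projective]
      exact Module.Projective.of_equiv (Submodule.quotEquivOfEqBot _ (by simp)).symm
    exact projective_iff_hasProjectiveDimensionLT_one.1 this
  | insert v s hv ih =>
    rw [Finset.card_insert_of_notMem hv, Finset.coe_insert, Set.image_insert_eq, Ideal.span_insert,
      sup_comm]
    exact (quotientMulShortComplex_shortExact fun a =>
      (X_mul_mem_span_X_image (by simpa using hv)).1).hasProjectiveDimensionLT_X₃ _ ih
        (hasProjectiveDimensionLT_of_ge _ (s.card + 1) _ (Nat.le_succ _))

/-- The target is killed by every variable, so each adjoined variable raises the degree of a nonzero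
`Ext` class by one, starting from the projection `S → S/(all variables)`. -/
theorem nontrivial_ext_quotient_span_X_image (s : Finset V) :
    Nontrivial (Ext (ModuleCat.of (MvPolynomial V k)
      (MvPolynomial V k ⧸ Ideal.span (X '' (s : Set V) : Set (MvPolynomial V k))))
      (ModuleCat.of (MvPolynomial V k)
        (MvPolynomial V k ⧸ Ideal.span (Set.range X : Set (MvPolynomial V k)))) s.card) := by
  classical
  induction s using Finset.induction_on with
  | empty =>
    rw [Finset.card_empty]
    refine Ext.homEquiv₀.nontrivial_congr.2 (nontrivial_of_ne (ModuleCat.ofHom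
      (Submodule.factor (by simp :
        Ideal.span (X '' ((∅ : Finset V) : Set V) : Set (MvPolynomial V k)) ≤
          Ideal.span (Set.range X : Set (MvPolynomial V k))))) 0 fun h => ?_)
    have h1 := congrArg (fun f => f.hom (Submodule.Quotient.mk 1)) h
    have h2 : (1 : MvPolynomial V k) ∈ Ideal.span (Set.range X) :=
      (Submodule.Quotient.mk_eq_zero _).1 h1
    rw [← Set.image_univ, mem_ideal_span_X_image] at h2
    obtain ⟨i, -, hi⟩ := h2 0 (by simp)
    exact hi rfl
  | insert v s hv ih =>
    rw [Finset.card_insert_of_notMem hv, Finset.coe_insert, Set.image_insert_eq, Ideal.span_insert,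
      sup_comm]
    refine nontrivial_ext_quotient_sup_span_singleton
      (fun a => (X_mul_mem_span_X_image (by simpa using hv)).1) ?_ ih
    refine ModuleCat.hom_ext (LinearMap.ext fun a => ?_)
    obtain ⟨a, rfl⟩ := Submodule.Quotient.mk_surjective _ a
    refine (Submodule.Quotient.mk_eq_zero _ (x := X v * a)).2 ?_
    exact Ideal.mul_mem_right _ _ (Ideal.subset_span ⟨v, rfl⟩)

theorem projectiveDimension_quotient_span_X_image (s : Finset V) :
    projectiveDimension (ModuleCat.of (MvPolynomial V k)
      (MvPolynomial V k ⧸ Ideal.span (X '' (s : Set V) : Set (MvPolynomial V k)))) = s.card := by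
  apply le_antisymm
  · rw [projectiveDimension_le_iff]
    exact hasProjectiveDimensionLT_quotient_span_X_image s
  · rw [projectiveDimension_ge_iff]
    exact fun h => not_subsingleton_iff_nontrivial.2 (nontrivial_ext_quotient_span_X_image s)
      (h.subsingleton _ _ _ le_rfl _)

theorem edgeRingProjDim_eq_of_edgeIdeal_eq {G : SimpleGraph V} {I : Ideal (MvPolynomial V k)}
    (h : edgeIdeal k G = I) : edgeRingProjDim k G =
      projectiveDimension (ModuleCat.of (MvPolynomial V k) (MvPolynomial V k ⧸ I)) := by
  subst h
  rfl

theorem edgeRingProjDim_completeBipartiteGraph [Fintype V] [Fintype W] [Nonempty V] [Nonempty W] :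
    edgeRingProjDim k (completeBipartiteGraph V W) =
      ((Fintype.card V + Fintype.card W - 1 : ℕ) : WithBot ℕ∞) := by
  classical
  have hV : 0 < Fintype.card V := Fintype.card_pos
  have hW : 0 < Fintype.card W := Fintype.card_pos
  have hn : Fintype.card V + Fintype.card W - 1 + 1 = Fintype.card V + Fintype.card W := by omega
  have hinl : (Set.range Sum.inl : Set (V ⊕ W)) =
      ((Finset.univ.map Function.Embedding.inl : Finset (V ⊕ W)) : Set (V ⊕ W)) := by simp
  have hinr : (Set.range Sum.inr : Set (V ⊕ W)) =
      ((Finset.univ.map Function.Embedding.inr : Finset (V ⊕ W)) : Set (V ⊕ W)) := by simp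
  rw [edgeRingProjDim_eq_of_edgeIdeal_eq
    (edgeIdeal_completeBipartiteGraph.trans bipartiteIdeal_univ_eq_inf)]
  apply projectiveDimension_quotient_inf_eq
  · rw [← projectiveDimension_lt_iff, hinl, projectiveDimension_quotient_span_X_image,
      Nat.cast_lt, Finset.card_map, Finset.card_univ]
    omega
  · rw [← projectiveDimension_lt_iff, hinr, projectiveDimension_quotient_span_X_image,
      Nat.cast_lt, Finset.card_map, Finset.card_univ]
    omega
  · rw [← Ideal.span_union, ← Set.image_union, Set.range_inl_union_range_inr, ← Finset.coe_univ,
      projectiveDimension_quotient_span_X_image, hn, Finset.card_univ, Fintype.card_sum]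

end EdgeRing

theorem corollary5 (k : Type u) [Field k] :
    (∀ r : ℕ, 1 ≤ r →
      edgeIdeal k (completeBipartiteGraph (Fin r) (Fin r)) =
          stanleyReisnerIdeal k (disjointUnionComplex (fullSimplex (Fin r)) (fullSimplex (Fin r))) ∧
      HasTwoLinearResolution (edgeIdeal k (completeBipartiteGraph (Fin r) (Fin r))) ∧
      ∃ p : ℕ,
        edgeRingProjDim k (completeBipartiteGraph (Fin r) (Fin r)) = p ∧
        (p : ℤ) = 2 * r - 1 ∧
        (p : ℤ) - (completeBipartiteGraph (Fin r) (Fin r)).maxDegree = r - 1) ∧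
    (∀ N : ℕ, ∃ (V : Type) (_ : Fintype V) (G : SimpleGraph V) (_ : DecidableRel G.Adj) (p : ℕ),
      HasTwoLinearResolution (edgeIdeal k G) ∧
      edgeRingProjDim k G = p ∧
      (N : ℤ) ≤ (p : ℤ) - G.maxDegree) := by
  have key (r : ℕ) (hr : 1 ≤ r) :
      edgeRingProjDim k (completeBipartiteGraph (Fin r) (Fin r)) = ((r + r - 1 : ℕ) : WithBot ℕ∞) := by
    have : Nonempty (Fin r) := ⟨⟨0, hr⟩⟩
    simpa only [Fintype.card_fin] using
      edgeRingProjDim_completeBipartiteGraph (k := k) (V := Fin r) (W := Fin r)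
  refine ⟨fun r hr => ⟨edgeIdeal_completeBipartiteGraph_eq_stanleyReisnerIdeal,
    hasTwoLinearResolution_completeBipartiteGraph, r + r - 1, key r hr, by omega, ?_⟩, fun N => ?_⟩
  · rw [maxDegree_completeBipartiteGraph_fin hr]
    omega
  -- The gap is `r - 1`, so `r = N + 1` gives exactly `N`.
  · refine ⟨_, inferInstance, completeBipartiteGraph (Fin (N + 1)) (Fin (N + 1)), inferInstance, _,
      hasTwoLinearResolution_completeBipartiteGraph, key _ N.succ_pos, ?_⟩
    rw [maxDegree_completeBipartiteGraph_fin N.succ_pos]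
    omega
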